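/- Let $n,a,b\ge 1$ be integers with $ab\mid n$, and suppose that it is not the case that both $b=1$ and $a<n$. Let $G=C(n;a,b)$ be the one-paired circulant, i.e. the graph on $\{0,1,\dots,n-1\}$ in which $u$ and $v$ are adjacent if and only if $|u-v|\in S$ or $n-|u-v|\in S$, where $$S=\{d\in\{1,\dots,\lfloor n/2\rfloor\} : a\mid d \text{ and } ab\nmid d\}.$$ Let $\mathrm{Ind}(G)$ be the simplicial complex of independent sets of $G$ (with $\emptyset$ as a face), and let $k$ be any field. A simplicial complex $\Delta$ is pure if all its facets have the same size. A pure complex $\Delta$ is - vertex decomposable if it is a simplex (its set of all vertices is a face; $\{\emptyset\}$ is included) or it has a vertex $x$ such that the link and the deletion of $x$ are both (pure and) vertex decomposable; - shellable if its facets can be ordered $F_1,\dots,F_t$ so that for all $j<i$ there are $x\in F_i\setminus F_j$ and $l<i$ with $F_i\setminus F_l=\{x\}$; - Cohen-Macaulay (over $k$) if for all faces $F$ and all $i<\dim \mathrm{link}_\Delta(F)$ one has $\tilde H_i(\mathrm{link}_\Delta(F);k)=0$; - Buchsbaum (over $k$) if the link of every vertex is Cohen-Macaulay over $k$. Say that $G$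 has one of these properties if $\mathrm{Ind}(G)$ does. Then: (i) each of the three properties "$G$ is vertex decomposable", "$G$ is shellable", "$G$ is Cohen-Macaulay" holds if and only if $n=ab$; (ii) $G$ is Buchsbaum but not Cohen-Macaulay if and only if $a=1$ and $ab<n$; (iii) $\mathrm{Ind}(G)$ is pure but not Buchsbaum if and only if $a>1$ and $ab<n$. -/

import Mathlib

/-- A (finite) abstract simplicial complex with vertices among the elements of `V`. As in
combinatorial commutative algebra, the empty set is always a face (of dimension `-1`).
Mathlib's `AbstractSimplicialComplex` has only nonempty faces and makes every element of the
ambient type a vertex; neither is suitable for links, deletions and reduced homology. -/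
structure SimpComplex (V : Type*) where
  faces : Finset (Finset V)
  empty_mem : ∅ ∈ faces
  down_closed : ∀ F ∈ faces, ∀ G, G ⊆ F → G ∈ faces

namespace SimpComplex

variable {V : Type*}

/-- Facets are the faces that are maximal with respect to inclusion. -/
def IsFacet (Δ : SimpComplex V) (F : Finset V) : Prop :=
  Maximal (fun G => G ∈ Δ.faces) F

/-- All facets have the same dimension. -/
def IsPure (Δ : SimpComplex V) : Prop :=
  ∀ F G, Δ.IsFacet F → Δ.IsFacet G → F.card = G.card

/-- The dimension, `max (|F| - 1)` over all faces `F`; it is `-1` for the complex `{∅}`. -/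
def dim (Δ : SimpComplex V) : ℤ :=
  ((Δ.faces.sup Finset.card : ℕ) : ℤ) - 1

section Decidable

variable [DecidableEq V]

/-- The set of all vertices of the complex (the elements that lie in some face). -/
def vertices (Δ : SimpComplex V) : Finset V :=
  Δ.faces.biUnion id

/-- A simplex: the set of all vertices is the unique facet. -/
def IsSimplex (Δ : SimpComplex V) : Prop :=
  ∀ F, Δ.IsFacet F ↔ F = Δ.vertices

/-- The link of a face `F`. -/
def link (Δ : SimpComplex V) (F : Finset V) (hF : F ∈ Δ.faces) : SimpComplex V where
  faces := Δ.faces.filter (fun G => Disjoint F G ∧ F ∪ G ∈ Δ.faces)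
  empty_mem := by simp [Δ.empty_mem, hF]
  down_closed := by
    intro G hG H hHG
    rw [Finset.mem_filter] at hG ⊢
    exact ⟨Δ.down_closed G hG.1 H hHG, hG.2.1.mono_right hHG,
      Δ.down_closed _ hG.2.2 _ (Finset.union_subset_union_right hHG)⟩

/-- The deletion of a vertex `x`: all faces that do not contain `x`. -/
def deletion (Δ : SimpComplex V) (x : V) : SimpComplex V where
  faces := Δ.faces.filter (fun G => ¬ {x} ⊆ G)
  empty_mem := by simp [Δ.empty_mem]
  down_closed := by
    intro G hG H hHG
    rw [Finset.mem_filter] at hG ⊢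
    exact ⟨Δ.down_closed G hG.1 H hHG, fun h => hG.2 (h.trans hHG)⟩

/-- (Pure) vertex decomposability. A simplex is pure, so that the first constructor
does not mention purity. -/
inductive VertexDecomposable : SimpComplex V → Prop
  | simplex (Δ : SimpComplex V) (h : Δ.IsSimplex) : VertexDecomposable Δ
  | shed (Δ : SimpComplex V) (hpure : Δ.IsPure) (x : V) (hx : {x} ∈ Δ.faces)
      (hlink : VertexDecomposable (Δ.link {x} hx))
      (hdel : VertexDecomposable (Δ.deletion x)) : VertexDecomposable Δ

/-- (Pure) shellability: the facets can be listed without repetition as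
`F 0, F 1, …, F (t - 1)` such that for all `j < i` there are `x ∈ F i \ F j`
and `l < i` with `F i \ F l = {x}`. -/
def Shellable (Δ : SimpComplex V) : Prop :=
  Δ.IsPure ∧ ∃ (t : ℕ) (F : Fin t → Finset V),
    Function.Injective F ∧ (∀ G, Δ.IsFacet G ↔ ∃ i, F i = G) ∧
    ∀ i j, j < i → ∃ x ∈ F i \ F j, ∃ l, l < i ∧ F i \ F l = {x}

end Decidable

section Homology

variable (k : Type*) [Field k] [LinearOrder V]

/-- The simplicial boundary map of the oriented augmented chain complex on all finite subsets
of the linearly ordered set `V`: the set `{v₀ < ⋯ < vᵢ}` is sent to the alternating sum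
`∑ⱼ (-1)ʲ {v₀, …, vᵢ} \ {vⱼ}`. In particular a point is sent to `∅`, and `∅` to `0`. -/
noncomputable def boundary : (Finset V →₀ k) →ₗ[k] (Finset V →₀ k) :=
  Finsupp.linearCombination k (fun s : Finset V =>
    ∑ x ∈ s, Finsupp.single (s.erase x) ((-1 : k) ^ (s.filter (fun y => y < x)).card))

/-- The oriented `i`-chains of `Δ`: the formal combinations of faces of dimension `i`. -/
noncomputable def chains (Δ : SimpComplex V) (i : ℤ) : Submodule k (Finset V →₀ k) :=
  Finsupp.supported k k {s : Finset V | s ∈ Δ.faces ∧ (s.card : ℤ) - 1 = i}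

/-- The reduced `i`-cycles of `Δ`. -/
noncomputable def cycles (Δ : SimpComplex V) (i : ℤ) : Submodule k (Finset V →₀ k) :=
  Δ.chains k i ⊓ LinearMap.ker (boundary k)

/-- The reduced `i`-boundaries of `Δ`. -/
noncomputable def boundaries (Δ : SimpComplex V) (i : ℤ) : Submodule k (Finset V →₀ k) :=
  (Δ.chains k (i + 1)).map (boundary k)

/-- The reduced simplicial homology `H̃ᵢ(Δ; k) = Zᵢ / Bᵢ`: the cycles modulo the boundaries
(realized as the image of the submodule `Zᵢ` in the quotient by `Bᵢ`). -/
abbrev ReducedHomology (Δ : SimpComplex V) (i : ℤ) : Type _ :=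
  (Δ.cycles k i).map (Δ.boundaries k i).mkQ

/-- (Pure) Cohen–Macaulay complexes over `k`: the reduced homology of every link vanishes
below the dimension of that link. -/
def CohenMacaulay (Δ : SimpComplex V) : Prop :=
  Δ.IsPure ∧ ∀ (F : Finset V) (hF : F ∈ Δ.faces) (i : ℤ), i < (Δ.link F hF).dim →
    Subsingleton ((Δ.link F hF).ReducedHomology k i)

/-- (Pure) Buchsbaum complexes over `k`: the link of every vertex is Cohen–Macaulay. -/
def Buchsbaum (Δ : SimpComplex V) : Prop :=
  Δ.IsPure ∧ ∀ (x : V) (hx : {x} ∈ Δ.faces), (Δ.link {x} hx).CohenMacaulay k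

end Homology

end SimpComplex

open Classical in
/-- The independence complex of a finite graph. -/
noncomputable def indComplex {V : Type*} [Fintype V] (G : SimpleGraph V) : SimpComplex V where
  faces := Finset.univ.filter (fun W : Finset V => G.IsIndepSet (W : Set V))
  empty_mem := by simp [SimpleGraph.isIndepSet_iff]
  down_closed := by
    intro F hF H hHF
    simp only [Finset.mem_filter, Finset.mem_univ, true_and] at hF ⊢
    exact hF.mono (Finset.coe_subset.mpr hHF)

/-- The circulant graph `Cₙ(S)` on `{0, …, n - 1}`, for `S ⊆ {1, …, ⌊n/2⌋}`. The subtraction in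
Mathlib's `circulantGraph` is that of `Fin n`, i.e. modulo `n`; so distinct `u`, `v` are adjacent
if and only if `|u - v| ∈ S` or `n - |u - v| ∈ S`. -/
def circulant (n : ℕ) [NeZero n] (S : Set ℕ) : SimpleGraph (Fin n) :=
  SimpleGraph.circulantGraph {d : Fin n | (d : ℕ) ∈ S}

/-- The one-paired circulant `C(n; a, b)` (for positive `a`, `b` with `a * b ∣ n`). -/
def onePairedCirculant (n : ℕ) [NeZero n] (a b : ℕ) : SimpleGraph (Fin n) :=
  circulant n {d | 1 ≤ d ∧ d ≤ n / 2 ∧ a ∣ d ∧ ¬ a * b ∣ d}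

/-! Since `a` and `a * b` divide `n`, two vertices are adjacent exactly when they are congruent mod
`a` but not mod `a * b`. A set is therefore independent iff it meets every class mod `a` inside a
single class mod `a * b`: `Ind(G)` is the join of `a` copies of a disjoint union of `b` simplices,
each on `n / (a * b)` vertices (`indComplex_onePairedCirculant`). A facet picks one class mod `a *
b` in each class mod `a`, so the complex is always pure.

If `n = a * b`, the simplices are points. Links and deletions of vertices in a join of discrete sets
are again joins of discrete sets, so induction on the vertices gives vertex decomposability
(`vertexDecomposable_fiberJoin_id`) and, by Mayer–Vietoris, vanishing homology below the top degree
(`cohenMacaulay_fiberJoin_id`). Shellability comes from exchanging single vertices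
(`shellable_fiberJoin_id`).

If `a * b < n`, then `b > 1` and every class mod `a * b` has at least two elements. Facets are
unions of such classes, so no two differ in exactly one vertex, whereas a vertex decomposable or
shellable complex with two facets has such a pair. A facet of the join of all but one factor has as
link a disjoint union of `b` simplices of positive dimension, which is disconnected; so
Cohen–Macaulayness fails. For `a > 1` that face is nonempty, so Buchsbaumness fails too; for `a = 1`
every vertex link is a simplex. -/

namespace SimpComplex

/-! ### Facets, links and deletions; adjacent facets and shellings. -/

section General

variable {V : Type*}

@[ext]
theorem ext {Δ Γ : SimpComplex V} (h : ∀ F, F ∈ Δ.faces ↔ F ∈ Γ.faces) : Δ = Γ := by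
  cases Δ
  cases Γ
  congr
  exact Finset.ext h

theorem IsFacet.eq_of_subset {Δ : SimpComplex V} {F G : Finset V} (hF : Δ.IsFacet F)
    (hG : G ∈ Δ.faces) (h : F ⊆ G) : F = G :=
  Maximal.eq_of_le hF hG h

theorem exists_isFacet_superset (Δ : SimpComplex V) {F : Finset V} (hF : F ∈ Δ.faces) :
    ∃ G, Δ.IsFacet G ∧ F ⊆ G := by
  obtain ⟨G, hFG, hG⟩ := Δ.faces.exists_le_maximal hF
  exact ⟨G, hG, hFG⟩

theorem card_lt_of_lt_dim {Δ : SimpComplex V} {i : ℤ} (h : i < Δ.dim) :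
    ∃ F ∈ Δ.faces, i < (F.card : ℤ) - 1 := by
  obtain ⟨F, hF, hFe⟩ := Finset.exists_mem_eq_sup Δ.faces ⟨∅, Δ.empty_mem⟩ Finset.card
  exact ⟨F, hF, by rwa [dim, hFe] at h⟩

theorem card_le_dim {Δ : SimpComplex V} {F : Finset V} (hF : F ∈ Δ.faces) :
    (F.card : ℤ) - 1 ≤ Δ.dim := by
  have : F.card ≤ Δ.faces.sup Finset.card := Finset.le_sup hF
  rw [dim]
  omega

variable [DecidableEq V]

theorem mem_link {Δ : SimpComplex V} {F : Finset V} {hF : F ∈ Δ.faces} {G : Finset V} :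
    G ∈ (Δ.link F hF).faces ↔ Disjoint F G ∧ F ∪ G ∈ Δ.faces := by
  simp only [link, Finset.mem_filter, and_iff_right_iff_imp]
  exact fun h => Δ.down_closed _ h.2 _ Finset.subset_union_right

theorem mem_deletion {Δ : SimpComplex V} {x : V} {G : Finset V} :
    G ∈ (Δ.deletion x).faces ↔ G ∈ Δ.faces ∧ x ∉ G := by
  simp [deletion]

theorem IsSimplex.isPure {Δ : SimpComplex V} (h : Δ.IsSimplex) : Δ.IsPure := by
  intro F G hF hG
  rw [(h F).1 hF, (h G).1 hG]

theorem VertexDecomposable.isPure {Δ : SimpComplex V} (h : Δ.VertexDecomposable) : Δ.IsPure := by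
  cases h with
  | simplex _ h => exact h.isPure
  | shed _ h => exact h

theorem isFacet_link_iff {Δ : SimpComplex V} {F : Finset V} {hF : F ∈ Δ.faces} {G : Finset V} :
    (Δ.link F hF).IsFacet G ↔ Disjoint F G ∧ Δ.IsFacet (F ∪ G) := by
  constructor
  · intro h
    have hm := mem_link.1 h.1
    refine ⟨hm.1, hm.2, fun H hH hle => ?_⟩
    have hFH : F ⊆ H := Finset.subset_union_left.trans hle
    have hmem : H \ F ∈ (Δ.link F hF).faces := by
      rw [mem_link, Finset.union_sdiff_of_subset hFH]
      exact ⟨Finset.disjoint_sdiff, hH⟩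
    have hG : G = H \ F := h.eq_of_subset hmem
      (Finset.subset_sdiff.2 ⟨Finset.subset_union_right.trans hle, hm.1.symm⟩)
    rw [hG, Finset.union_sdiff_of_subset hFH]
  · rintro ⟨hd, h⟩
    refine ⟨mem_link.2 ⟨hd, h.1⟩, fun H hH hle => ?_⟩
    have hm := mem_link.1 hH
    have he := h.eq_of_subset hm.2 (Finset.union_subset_union_right hle)
    intro v hv
    have hv' : v ∈ F ∪ G := he ▸ Finset.mem_union_right F hv
    exact (Finset.mem_union.1 hv').resolve_left fun hF' => Finset.disjoint_left.1 hm.1 hF' hv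

theorem IsPure.link {Δ : SimpComplex V} (h : Δ.IsPure) {F : Finset V} (hF : F ∈ Δ.faces) :
    (Δ.link F hF).IsPure := by
  intro G H hG hH
  rw [isFacet_link_iff] at hG hH
  have := h _ _ hG.2 hH.2
  rw [Finset.card_union_of_disjoint hG.1, Finset.card_union_of_disjoint hH.1] at this
  omega

theorem link_link {Δ : SimpComplex V} {F G H : Finset V} (hF : F ∈ Δ.faces)
    (hG : G ∈ (Δ.link F hF).faces) (hH : H ∈ Δ.faces) (h : F ∪ G = H) :
    (Δ.link F hF).link G hG = Δ.link H hH := by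
  subst h
  ext K
  simp only [mem_link, Finset.disjoint_union_left, Finset.disjoint_union_right,
    Finset.union_assoc]
  have := (mem_link.1 hG).1
  tauto

/-- Used as an obstruction. If the shedding vertex lies in two facets, induction applies to its
link; otherwise purity of the deletion provides the pair. -/
theorem VertexDecomposable.exists_adjacent_facets {Δ : SimpComplex V}
    (h : Δ.VertexDecomposable) {F G : Finset V} (hF : Δ.IsFacet F) (hG : Δ.IsFacet G)
    (hne : F ≠ G) : ∃ F' G' x, Δ.IsFacet F' ∧ Δ.IsFacet G' ∧ F' \ G' = {x} := by
  induction h generalizing F G with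
  | simplex Δ h => exact absurd (((h F).1 hF).trans ((h G).1 hG).symm) hne
  | shed Δ hpure x hx hlink hdel ih _ =>
    obtain ⟨E, hE, hxE⟩ := Δ.exists_isFacet_superset hx
    have hxE : x ∈ E := Finset.singleton_subset_iff.1 hxE
    have key : ∀ E', Δ.IsFacet E' → x ∈ E' → (Δ.link {x} hx).IsFacet (E'.erase x) := by
      intro E' hE' hx'
      rw [isFacet_link_iff]
      refine ⟨by simp, ?_⟩
      rwa [← Finset.insert_eq, Finset.insert_erase hx']
    by_cases hall : ∃ E', Δ.IsFacet E' ∧ x ∈ E' ∧ E' ≠ E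
    · obtain ⟨E', hE', hx', hne'⟩ := hall
      obtain ⟨A, B, y, hA, hB, hAB⟩ := ih (key E' hE' hx') (key E hE hxE) (by
        intro he
        apply hne'
        rw [← Finset.insert_erase hx', he, Finset.insert_erase hxE])
      rw [isFacet_link_iff] at hA hB
      refine ⟨_, _, y, hA.2, hB.2, ?_⟩
      rw [← hAB]
      ext v
      have hA' := hA.1
      simp only [Finset.disjoint_singleton_left] at hA'
      simp only [Finset.mem_sdiff, Finset.mem_union, Finset.mem_singleton]
      constructor
      · tauto
      · rintro ⟨h1, h2⟩
        refine ⟨Or.inr h1, ?_⟩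
        rintro (rfl | h3)
        · exact hA' h1
        · exact h2 h3
    -- Now `E` is the only facet through `x`. In the deletion, which is pure with facets as large as
    -- those of `Δ`, `E.erase x` extends to a facet `K`; then `K` is a facet of `Δ` and `E \ K =
    -- {x}`.
    · push Not at hall
      obtain ⟨H, hH, hxH⟩ : ∃ H, Δ.IsFacet H ∧ x ∉ H := by
        by_contra! hcon
        exact hne ((hall F hF (hcon F hF)).trans (hall G hG (hcon G hG)).symm)
      have hHdel : (Δ.deletion x).IsFacet H :=
        ⟨mem_deletion.2 ⟨hH.1, hxH⟩, fun K hK hle => hH.2 (mem_deletion.1 hK).1 hle⟩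
      have hLdel : E.erase x ∈ (Δ.deletion x).faces :=
        mem_deletion.2 ⟨Δ.down_closed _ hE.1 _ (Finset.erase_subset _ _),
          Finset.notMem_erase _ _⟩
      obtain ⟨K, hK, hLK⟩ := exists_isFacet_superset _ hLdel
      have hcard : K.card = H.card := hdel.isPure _ _ hK hHdel
      have hKm := mem_deletion.1 hK.1
      obtain ⟨K', hK', hKK'⟩ := Δ.exists_isFacet_superset hKm.1
      have hKeq : K = K' :=
        Finset.eq_of_subset_of_card_le hKK' (by rw [hcard, hpure _ _ hK' hH])
      refine ⟨E, K, x, hE, hKeq ▸ hK', ?_⟩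
      ext v
      simp only [Finset.mem_sdiff, Finset.mem_singleton]
      constructor
      · rintro ⟨h1, h2⟩
        by_contra hv
        exact h2 (hLK (Finset.mem_erase.2 ⟨hv, h1⟩))
      · rintro rfl
        exact ⟨hxE, hKm.2⟩

theorem Shellable.exists_adjacent_facets {Δ : SimpComplex V} (h : Δ.Shellable)
    {F G : Finset V} (hF : Δ.IsFacet F) (hG : Δ.IsFacet G) (hne : F ≠ G) :
    ∃ F' G' x, Δ.IsFacet F' ∧ Δ.IsFacet G' ∧ F' \ G' = {x} := by
  obtain ⟨_, t, E, hinj, hfac, hsh⟩ := h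
  obtain ⟨i, rfl⟩ := (hfac F).1 hF
  obtain ⟨j, rfl⟩ := (hfac G).1 hG
  have hij : i ≠ j := fun h => hne (h ▸ rfl)
  rcases lt_or_gt_of_ne hij with hlt | hlt
  · obtain ⟨x, _, l, _, hl⟩ := hsh j i hlt
    exact ⟨_, _, x, hG, (hfac _).2 ⟨l, rfl⟩, hl⟩
  · obtain ⟨x, _, l, _, hl⟩ := hsh i j hlt
    exact ⟨_, _, x, hF, (hfac _).2 ⟨l, rfl⟩, hl⟩

/-- Sorting the facets by a weight that can be decreased by single exchanges gives a shelling. -/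
theorem shellable_of_weight {Δ : SimpComplex V} (hpure : Δ.IsPure) (w : Finset V → ℕ)
    (h : ∀ F G, Δ.IsFacet F → Δ.IsFacet G → F ≠ G → w G ≤ w F →
      ∃ x ∈ F \ G, ∃ H, Δ.IsFacet H ∧ w H < w F ∧ F \ H = {x}) : Δ.Shellable := by
  classical
  let S : Finset (Finset V) := Δ.faces.filter Δ.IsFacet
  have hS : ∀ F, F ∈ S ↔ Δ.IsFacet F := fun F => by
    simp only [S, Finset.mem_filter, and_iff_right_iff_imp]
    exact fun h => h.1
  let e : S ≃ Fin S.card := S.equivFin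
  let f : Fin S.card → ℕ := fun i => w (e.symm i)
  let E : Fin S.card → Finset V := fun i => e.symm (Tuple.sort f i)
  have hEinj : Function.Injective E := fun i j hij =>
    (Tuple.sort f).injective (e.symm.injective (Subtype.ext hij))
  have hmono : Monotone fun i => w (E i) := Tuple.monotone_sort f
  have hfac : ∀ G, Δ.IsFacet G ↔ ∃ i, E i = G := by
    intro G
    constructor
    · intro hG
      refine ⟨(Tuple.sort f).symm (e ⟨G, (hS G).2 hG⟩), ?_⟩
      simp [E]
    · rintro ⟨i, rfl⟩
      exact (hS _).1 (e.symm (Tuple.sort f i)).2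
  refine ⟨hpure, S.card, E, hEinj, hfac, fun i j hji => ?_⟩
  obtain ⟨x, hx, H, hH, hw, hd⟩ := h (E i) (E j) ((hfac _).2 ⟨i, rfl⟩) ((hfac _).2 ⟨j, rfl⟩)
    (fun he => hji.ne' (hEinj he)) (hmono hji.le)
  obtain ⟨l, rfl⟩ := (hfac H).1 hH
  exact ⟨x, hx, l, lt_of_not_ge fun hle => absurd (hmono hle) (not_le.2 hw), hd⟩

end General

/-! ### Joins of disjoint unions of simplices. -/

section Join

variable {V C D : Type*}

open Classical in
/-- The restriction to `W` of the complex of all sets that meet every fibre of `p` in a subset of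
a single fibre of `q`. If `q` refines `p`, then this is the join over the values of `p` of
disjoint unions of simplices, namely the fibres of `q`. -/
noncomputable def fiberJoin (W : Finset V) (p : V → C) (q : V → D) : SimpComplex V where
  faces := W.powerset.filter fun F => ∀ u ∈ F, ∀ v ∈ F, p u = p v → q u = q v
  empty_mem := by simp
  down_closed := by
    intro F hF G hGF
    simp only [Finset.mem_filter, Finset.mem_powerset] at hF ⊢
    exact ⟨hGF.trans hF.1, fun u hu v hv => hF.2 u (hGF hu) v (hGF hv)⟩

theorem mem_fiberJoin {W F : Finset V} {p : V → C} {q : V → D} :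
    F ∈ (fiberJoin W p q).faces ↔ F ⊆ W ∧ ∀ u ∈ F, ∀ v ∈ F, p u = p v → q u = q v := by
  simp [fiberJoin]

variable {W F : Finset V} {p : V → C} {q : V → D}

theorem singleton_mem_fiberJoin {x : V} : {x} ∈ (fiberJoin W p q).faces ↔ x ∈ W := by
  simp +contextual [mem_fiberJoin]

theorem exists_ne_isFacet_fiberJoin {u v : V} (hu : u ∈ W) (hv : v ∈ W) (hp : p u = p v)
    (hq : q u ≠ q v) :
    ∃ F G, (fiberJoin W p q).IsFacet F ∧ (fiberJoin W p q).IsFacet G ∧ F ≠ G := by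
  obtain ⟨F, hF, huF⟩ := exists_isFacet_superset _ (singleton_mem_fiberJoin (p := p) (q := q).2 hu)
  obtain ⟨G, hG, hvG⟩ := exists_isFacet_superset _ (singleton_mem_fiberJoin (p := p) (q := q).2 hv)
  refine ⟨F, G, hF, hG, ?_⟩
  rintro rfl
  exact hq ((mem_fiberJoin.1 hF.1).2 u (huF (by simp)) v (hvG (by simp)) hp)

section

variable [DecidableEq V]

theorem insert_mem_fiberJoin (hF : F ∈ (fiberJoin W p q).faces) {v : V} (hv : v ∈ W)
    (h : ∀ t ∈ F, p t = p v → q t = q v) : insert v F ∈ (fiberJoin W p q).faces := by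
  have hm := mem_fiberJoin.1 hF
  refine mem_fiberJoin.2 ⟨Finset.insert_subset hv hm.1, fun s hs t ht hst => ?_⟩
  rcases Finset.mem_insert.1 hs with hsv | hs <;> rcases Finset.mem_insert.1 ht with htv | ht
  · rw [hsv, htv]
  · rw [hsv] at hst ⊢
    exact (h t ht hst.symm).symm
  · rw [htv] at hst ⊢
    exact h s hs hst
  · exact hm.2 s hs t ht hst

theorem exists_mem_of_isFacet_fiberJoin (hF : (fiberJoin W p q).IsFacet F) {v : V} (hv : v ∈ W) :
    ∃ u ∈ F, p u = p v := by
  by_contra! hcon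
  have hmem : insert v F ∈ (fiberJoin W p q).faces :=
    insert_mem_fiberJoin hF.1 hv fun t ht h => absurd h (hcon t ht)
  have hvF : v ∈ F := by
    rw [hF.eq_of_subset hmem (Finset.subset_insert _ _)]
    exact Finset.mem_insert_self _ _
  exact hcon v hvF rfl

theorem mem_of_isFacet_fiberJoin (hpq : ∀ u v, q u = q v → p u = p v)
    (hF : (fiberJoin W p q).IsFacet F) {u v : V} (hu : u ∈ F) (hv : v ∈ W) (h : q v = q u) :
    v ∈ F := by
  have hm := mem_fiberJoin.1 hF.1
  have hmem : insert v F ∈ (fiberJoin W p q).faces :=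
    insert_mem_fiberJoin hF.1 hv fun t ht htv =>
      (hm.2 t ht u hu (htv.trans (hpq _ _ h))).trans h.symm
  rw [hF.eq_of_subset hmem (Finset.subset_insert _ _)]
  exact Finset.mem_insert_self _ _

/-- By maximality a facet meets each nonempty fibre of `p` in exactly one whole fibre of `q`. -/
theorem card_of_isFacet_fiberJoin [DecidableEq C] [DecidableEq D]
    (hpq : ∀ u v, q u = q v → p u = p v) {m : ℕ}
    (hm : ∀ v ∈ W, (W.filter fun u => q u = q v).card = m)
    (hF : (fiberJoin W p q).IsFacet F) : F.card = (W.image p).card * m := by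
  have hface := mem_fiberJoin.1 hF.1
  rw [Finset.card_eq_sum_card_fiberwise (f := p) (t := W.image p)
    fun v hv => Finset.mem_image_of_mem p (hface.1 hv)]
  refine Finset.sum_const_nat fun c hc => ?_
  obtain ⟨v, hv, rfl⟩ := Finset.mem_image.1 hc
  obtain ⟨u, hu, huv⟩ := exists_mem_of_isFacet_fiberJoin hF hv
  rw [← hm u (hface.1 hu)]
  congr 1
  ext t
  simp only [Finset.mem_filter]
  constructor
  · rintro ⟨ht, htv⟩
    exact ⟨hface.1 ht, hface.2 t ht u hu (htv.trans huv.symm)⟩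
  · rintro ⟨ht, htu⟩
    exact ⟨mem_of_isFacet_fiberJoin hpq hF hu ht htu, (hpq _ _ htu).trans huv⟩

theorem isPure_fiberJoin [DecidableEq D] (hpq : ∀ u v, q u = q v → p u = p v) {m : ℕ}
    (hm : ∀ v ∈ W, (W.filter fun u => q u = q v).card = m) : (fiberJoin W p q).IsPure := by
  classical
  intro F G hF hG
  rw [card_of_isFacet_fiberJoin hpq hm hF, card_of_isFacet_fiberJoin hpq hm hG]

theorem isPure_fiberJoin_of_injOn [DecidableEq D] (hpq : ∀ u v, q u = q v → p u = p v)
    (hq : Function.Injective q) : (fiberJoin W p q).IsPure := by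
  refine isPure_fiberJoin hpq (m := 1) fun v hv => Finset.card_eq_one.2 ⟨v, ?_⟩
  ext u
  simp only [Finset.mem_filter, Finset.mem_singleton, hq.eq_iff]
  exact ⟨fun h => h.2, fun h => ⟨h ▸ hv, h⟩⟩

/-- Facets are unions of whole fibres of `q`, hence so are their differences. -/
theorem sdiff_ne_singleton_of_isFacet_fiberJoin (hpq : ∀ u v, q u = q v → p u = p v)
    (hm : ∀ v ∈ W, ∃ u ∈ W, u ≠ v ∧ q u = q v) {G : Finset V}
    (hF : (fiberJoin W p q).IsFacet F) (hG : (fiberJoin W p q).IsFacet G) (x : V) :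
    F \ G ≠ {x} := by
  intro h
  have hx : x ∈ F \ G := h ▸ Finset.mem_singleton_self x
  rw [Finset.mem_sdiff] at hx
  have hxW := (mem_fiberJoin.1 hF.1).1 hx.1
  obtain ⟨u, hu, hne, hux⟩ := hm x hxW
  have : u ∈ F \ G := Finset.mem_sdiff.2 ⟨mem_of_isFacet_fiberJoin hpq hF hx.1 hu hux,
    fun huG => hx.2 (mem_of_isFacet_fiberJoin hpq hG huG hxW hux.symm)⟩
  rw [h, Finset.mem_singleton] at this
  exact hne this

/-- With `q = id` a face has at most one vertex of each colour `p`, so passing to the link just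
removes the colours of `F`. This keeps inductions inside the family. -/
theorem link_fiberJoin_id [DecidableEq C] (hF : F ∈ (fiberJoin W p id).faces) :
    (fiberJoin W p id).link F hF = fiberJoin (W.filter fun v => p v ∉ F.image p) p id := by
  have hm := mem_fiberJoin.1 hF
  ext G
  rw [mem_link, mem_fiberJoin, mem_fiberJoin]
  simp only [id] at hm ⊢
  constructor
  · rintro ⟨hd, hs, h⟩
    refine ⟨fun v hv => ?_, fun u hu v hv => h u (Finset.mem_union_right _ hu) v
      (Finset.mem_union_right _ hv)⟩
    simp only [Finset.mem_filter, Finset.mem_image, not_exists, not_and]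
    refine ⟨hs (Finset.mem_union_right _ hv), fun u hu huv => ?_⟩
    have := h u (Finset.mem_union_left _ hu) v (Finset.mem_union_right _ hv) huv
    exact Finset.disjoint_left.1 hd hu (this ▸ hv)
  · rintro ⟨hs, h⟩
    have hp : ∀ u ∈ F, ∀ v ∈ G, p u ≠ p v := fun u hu v hv he =>
      (Finset.mem_filter.1 (hs hv)).2 (Finset.mem_image.2 ⟨u, hu, he⟩)
    refine ⟨Finset.disjoint_left.2 fun u hu hu' => hp u hu u hu' rfl,
      Finset.union_subset hm.1 (hs.trans (Finset.filter_subset _ _)), ?_⟩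
    intro u hu v hv huv
    rcases Finset.mem_union.1 hu with hu | hu <;> rcases Finset.mem_union.1 hv with hv | hv
    · exact hm.2 u hu v hv huv
    · exact absurd huv (hp u hu v hv)
    · exact absurd huv.symm (hp v hv u hu)
    · exact h u hu v hv huv

theorem deletion_fiberJoin (x : V) :
    (fiberJoin W p q).deletion x = fiberJoin (W.erase x) p q := by
  ext G
  rw [mem_deletion, mem_fiberJoin, mem_fiberJoin, Finset.subset_erase]
  tauto

theorem vertexDecomposable_fiberJoin_id (W : Finset V) (p : V → C) :
    (fiberJoin W p id).VertexDecomposable := by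
  classical
  induction W using Finset.strongInduction with
  | H W ih =>
    rcases W.eq_empty_or_nonempty with rfl | ⟨x, hx⟩
    · have hf : ∀ F, F ∈ (fiberJoin (∅ : Finset V) p id).faces ↔ F = ∅ := by
        intro F
        rw [mem_fiberJoin, Finset.subset_empty, and_iff_left_iff_imp]
        rintro rfl
        simp
      refine .simplex _ fun F => ?_
      have hv : (fiberJoin (∅ : Finset V) p id).vertices = ∅ := by
        ext v
        simp [vertices, hf]
      rw [hv]
      constructor
      · exact fun h => (hf F).1 h.1
      · rintro rfl
        exact ⟨(hf _).2 rfl, fun G hG _ => ((hf G).1 hG).le⟩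
    · have hx' := singleton_mem_fiberJoin (p := p) (q := id).2 hx
      refine .shed _ (isPure_fiberJoin_of_injOn (fun u v h => congrArg p h)
        Function.injective_id) x hx' ?_ ?_
      · rw [link_fiberJoin_id]
        exact ih _ (Finset.filter_ssubset.2 ⟨x, hx, by simp⟩)
      · rw [deletion_fiberJoin]
        exact ih _ (Finset.erase_ssubset hx)

theorem isFacet_fiberJoin_id_iff :
    (fiberJoin W p id).IsFacet F ↔ F ∈ (fiberJoin W p id).faces ∧ ∀ v ∈ W, ∃ u ∈ F, p u = p v := by
  constructor
  · exact fun h => ⟨h.1, fun v hv => exists_mem_of_isFacet_fiberJoin h hv⟩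
  · rintro ⟨h, hall⟩
    refine ⟨h, fun G hG hFG v hv => ?_⟩
    have hm := mem_fiberJoin.1 hG
    obtain ⟨u, hu, huv⟩ := hall v (hm.1 hv)
    have : u = v := hm.2 u (hFG hu) v hv huv
    exact this ▸ hu

theorem shellable_fiberJoin_id (W : Finset V) (p : V → C) (w : V → ℕ)
    (hw : Function.Injective w) : (fiberJoin W p id).Shellable := by
  classical
  refine shellable_of_weight (isPure_fiberJoin_of_injOn (fun u v h => congrArg p h)
        Function.injective_id) (fun F => ∑ v ∈ F, w v) ?_
  intro F G hF hG hne hle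
  have hFm := mem_fiberJoin.1 hF.1
  have hGm := mem_fiberJoin.1 hG.1
  have hcard := isPure_fiberJoin_of_injOn (W := W) (fun u v h => congrArg p h)
        Function.injective_id _ _ hF hG
  -- Otherwise the colour-preserving bijection `g` from `F` to `G` never lowers `w`. As the total
  -- weight of `G` is at most that of `F`, it preserves `w`, so it is the identity and `F = G`.
  have hex : ∃ x ∈ F, ∃ y ∈ G, p x = p y ∧ w y < w x := by
    by_contra! hcon
    choose! g hgG hpg using fun x (hx : x ∈ F) => exists_mem_of_isFacet_fiberJoin hG (hFm.1 hx)
    have hinj : Set.InjOn g F := fun u hu v hv huv => hFm.2 u hu v hv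
      ((hpg u hu).symm.trans ((congrArg p huv).trans (hpg v hv)))
    have himg : F.image g = G := by
      refine Finset.eq_of_subset_of_card_le (Finset.image_subset_iff.2 hgG) ?_
      rw [Finset.card_image_of_injOn hinj, hcard]
    have hsum : ∑ v ∈ G, w v = ∑ v ∈ F, w (g v) := by
      rw [← himg, Finset.sum_image hinj]
    have hwle : ∀ v ∈ F, w v ≤ w (g v) := fun v hv => hcon v hv _ (hgG v hv) (hpg v hv).symm
    have heq := (Finset.sum_eq_sum_iff_of_le hwle).1
      (le_antisymm (Finset.sum_le_sum hwle) (hsum ▸ hle))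
    apply hne
    rw [← himg]
    ext t
    simp only [Finset.mem_image]
    constructor
    · exact fun ht => ⟨t, ht, (hw (heq t ht)).symm⟩
    · rintro ⟨s, hs, rfl⟩
      rwa [← hw (heq s hs)]
  obtain ⟨x, hx, y, hy, hxy, hlt⟩ := hex
  have hxy' : x ≠ y := fun h => hlt.ne (h ▸ rfl)
  have hxG : x ∉ G := fun h => hxy' (hGm.2 x h y hy hxy)
  have hyF : y ∉ F := fun h => hxy' (hFm.2 x hx y h hxy)
  -- Exchanging `x` for the lighter `y` of the same colour gives a facet of smaller weight.
  refine ⟨x, Finset.mem_sdiff.2 ⟨hx, hxG⟩, insert y (F.erase x), ?_, ?_, ?_⟩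
  · rw [isFacet_fiberJoin_id_iff]
    refine ⟨insert_mem_fiberJoin (down_closed _ F hF.1 _ (Finset.erase_subset _ _)) (hGm.1 hy)
      fun t ht h => ?_, ?_⟩
    · exact absurd (hFm.2 t (Finset.mem_of_mem_erase ht) x hx (h.trans hxy.symm))
        (Finset.mem_erase.1 ht).1
    · intro v hv
      obtain ⟨u, hu, huv⟩ := exists_mem_of_isFacet_fiberJoin hF hv
      by_cases hux : u = x
      · exact ⟨y, by simp, hxy.symm.trans (hux ▸ huv)⟩
      · exact ⟨u, by simp [hux, hu], huv⟩
  · rw [Finset.sum_insert (by simp [hyF]), ← Finset.add_sum_erase F w hx]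
    omega
  · ext t
    simp only [Finset.mem_sdiff, Finset.mem_insert, Finset.mem_erase, Finset.mem_singleton]
    constructor
    · tauto
    · rintro rfl
      tauto

end

end Join

end SimpComplex

/-! ### Reduced homology: cones, links and deletions, disconnectedness. -/

namespace SimpComplex

section Acyclicity

variable (k : Type*) [Field k] {V : Type*} [LinearOrder V]

theorem boundary_single (s : Finset V) :
    boundary k (Finsupp.single s 1) = ∑ x ∈ s,
      Finsupp.single (s.erase x) ((-1 : k) ^ (s.filter (fun y => y < x)).card) := by
  simp [boundary]

/-- The operator that joins the vertex `x` to a chain. -/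
noncomputable def joinVertex (x : V) : (Finset V →₀ k) →ₗ[k] (Finset V →₀ k) :=
  Finsupp.linearCombination k fun s : Finset V =>
    if x ∈ s then 0
    else Finsupp.single (insert x s) ((-1 : k) ^ (s.filter (fun y => y < x)).card)

theorem joinVertex_single_of_mem {x : V} {s : Finset V} (h : x ∈ s) (c : k) :
    joinVertex k x (Finsupp.single s c) = 0 := by
  simp [joinVertex, h]

theorem joinVertex_single_of_notMem {x : V} {s : Finset V} (h : x ∉ s) (c : k) :
    joinVertex k x (Finsupp.single s c) =
      Finsupp.single (insert x s) (c * (-1 : k) ^ (s.filter (fun y => y < x)).card) := by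
  simp [joinVertex, h]

/-- Inserting `x` and erasing `y` anticommute: exactly one of the two counts shifts by one,
according to which of `x`, `y` is smaller. -/
theorem sign_insert_mul {x y : V} {s : Finset V} (hx : x ∉ s) (hy : y ∈ s) :
    (-1 : k) ^ (s.filter (fun z => z < x)).card *
        (-1 : k) ^ ((insert x s).filter (fun z => z < y)).card =
      -((-1 : k) ^ (s.filter (fun z => z < y)).card *
        (-1 : k) ^ ((s.erase y).filter (fun z => z < x)).card) := by
  have hxy : y ≠ x := fun h => hx (h ▸ hy)
  rcases lt_or_gt_of_ne hxy with h | h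
  · have h1 : (s.filter (fun z => z < x)).card = ((s.erase y).filter (fun z => z < x)).card + 1 := by
      rw [Finset.filter_erase, Finset.card_erase_add_one (by simp [hy, h])]
    have h2 : (insert x s).filter (fun z => z < y) = s.filter (fun z => z < y) := by
      rw [Finset.filter_insert, if_neg h.le.not_gt]
    rw [h1, h2, pow_succ]
    ring
  · have h1 : (s.erase y).filter (fun z => z < x) = s.filter (fun z => z < x) := by
      rw [Finset.filter_erase, Finset.erase_eq_of_notMem (by simp [h.le])]
    have h2 : ((insert x s).filter (fun z => z < y)).card =
        (s.filter (fun z => z < y)).card + 1 := by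
      rw [Finset.filter_insert, if_pos h, Finset.card_insert_of_notMem (by simp [hx])]
    rw [h1, h2, pow_succ]
    ring

/-- Joining a vertex is a contracting homotopy of the augmented complex of all finite sets. -/
theorem boundary_joinVertex_add (x : V) (c : Finset V →₀ k) :
    boundary k (joinVertex k x c) + joinVertex k x (boundary k c) = c := by
  have hsq : ∀ r : ℕ, (-1 : k) ^ r * (-1 : k) ^ r = 1 := fun r => by
    rw [← pow_add, ← two_mul, pow_mul]
    simp
  suffices h : boundary k ∘ₗ joinVertex k x + joinVertex k x ∘ₗ boundary k = LinearMap.id from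
    LinearMap.congr_fun h c
  refine Finsupp.lhom_ext' fun s => LinearMap.ext_ring ?_
  simp only [LinearMap.comp_apply, LinearMap.add_apply, Finsupp.lsingle_apply, LinearMap.id_apply,
    boundary_single, map_sum]
  by_cases hx : x ∈ s
  -- If `x ∈ s`, only the boundary term that erases `x` survives rejoining `x`, and it returns `s`.
  · rw [joinVertex_single_of_mem k hx, map_zero, zero_add, Finset.sum_eq_single_of_mem x hx]
    · rw [joinVertex_single_of_notMem k (Finset.notMem_erase x s), Finset.insert_erase hx,
        Finset.filter_erase, Finset.erase_eq_of_notMem (by simp), hsq]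
    · intro y hy hyx
      exact joinVertex_single_of_mem k (Finset.mem_erase.2 ⟨hyx.symm, hx⟩) _
  -- If `x ∉ s`, erasing `x` from `insert x s` returns `s`; the remaining terms cancel in pairs.
  · rw [joinVertex_single_of_notMem k hx, one_mul, ← mul_one ((-1 : k) ^ _), ← smul_eq_mul,
      ← Finsupp.smul_single, map_smul, boundary_single, Finset.sum_insert hx, smul_add,
      Finset.erase_insert hx, Finset.filter_insert, if_neg (lt_irrefl x), Finsupp.smul_single,
      smul_eq_mul, hsq, add_assoc, Finset.smul_sum, ← Finset.sum_add_distrib,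
      Finset.sum_eq_zero, add_zero]
    intro y hy
    have hxy : x ≠ y := fun h => hx (h ▸ hy)
    rw [joinVertex_single_of_notMem k (fun h => hx (Finset.mem_of_mem_erase h)),
      Finsupp.smul_single, smul_eq_mul, Finset.erase_insert_of_ne hxy, sign_insert_mul k hx hy,
      ← Finsupp.single_add, neg_add_cancel, Finsupp.single_zero]

variable {k}

theorem linearCombination_mem {α M : Type*} [AddCommGroup M] [Module k M] {f : α → M}
    {S : Set α} {N : Submodule k M} (h : ∀ s ∈ S, f s ∈ N) {c : α →₀ k}
    (hc : c ∈ Finsupp.supported k k S) : Finsupp.linearCombination k f c ∈ N := by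
  rw [Finsupp.linearCombination_apply]
  exact N.sum_mem fun s hs => N.smul_mem _ (h s (hc hs))

theorem boundary_mem_supported {S T : Set (Finset V)} (h : ∀ s ∈ S, ∀ x ∈ s, s.erase x ∈ T)
    {c : Finset V →₀ k} (hc : c ∈ Finsupp.supported k k S) :
    boundary k c ∈ Finsupp.supported k k T :=
  linearCombination_mem (fun s hs => Submodule.sum_mem _ fun x hx =>
    Finsupp.single_mem_supported k _ (h s hs x hx)) hc

theorem joinVertex_mem_supported {S T : Set (Finset V)} {x : V}
    (h : ∀ s ∈ S, x ∉ s → insert x s ∈ T) {c : Finset V →₀ k}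
    (hc : c ∈ Finsupp.supported k k S) : joinVertex k x c ∈ Finsupp.supported k k T := by
  refine linearCombination_mem (fun s hs => ?_) hc
  split_ifs with hx
  · exact Submodule.zero_mem _
  · exact Finsupp.single_mem_supported k _ (h s hs hx)

variable (k) in
theorem subsingleton_reducedHomology_iff {Δ : SimpComplex V} {i : ℤ} :
    Subsingleton (Δ.ReducedHomology k i) ↔
      ∀ z ∈ Δ.chains k i, boundary k z = 0 → ∃ w ∈ Δ.chains k (i + 1), boundary k w = z := by
  rw [Submodule.subsingleton_iff_eq_bot, ← le_bot_iff, Submodule.map_le_iff_le_comap,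
    Submodule.comap_bot, Submodule.ker_mkQ]
  constructor
  · intro h z hz hz0
    exact h ⟨hz, hz0⟩
  · rintro h z ⟨hz, hz0⟩
    exact h z hz hz0

/-- By the homotopy formula, a cycle is the boundary of its join with the apex. -/
theorem subsingleton_reducedHomology_of_cone {Δ : SimpComplex V} {x : V}
    (h : ∀ F ∈ Δ.faces, insert x F ∈ Δ.faces) (i : ℤ) :
    Subsingleton (Δ.ReducedHomology k i) := by
  rw [subsingleton_reducedHomology_iff]
  intro z hz hz0
  refine ⟨joinVertex k x z, joinVertex_mem_supported (fun s hs hx => ?_) hz, ?_⟩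
  · refine ⟨h s hs.1, ?_⟩
    have := hs.2
    rw [Finset.card_insert_of_notMem hx]
    push_cast
    omega
  · have := boundary_joinVertex_add k x z
    rwa [hz0, map_zero, add_zero] at this

theorem subsingleton_reducedHomology_of_lt {Δ : SimpComplex V} {i : ℤ} (hi : i < -1) :
    Subsingleton (Δ.ReducedHomology k i) := by
  rw [subsingleton_reducedHomology_iff]
  intro z hz _
  refine ⟨0, Submodule.zero_mem _, ?_⟩
  have hempty : {s : Finset V | s ∈ Δ.faces ∧ (s.card : ℤ) - 1 = i} = ∅ := by
    ext s
    simp only [Set.mem_ofPred_eq, Set.mem_empty_iff_false, iff_false, not_and]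
    intro _
    omega
  rw [chains, hempty, Finsupp.supported_empty, Submodule.mem_bot] at hz
  rw [hz, map_zero]

/-- The part of the Mayer–Vietoris sequence of the link and the deletion of a vertex
that bounds the homology of a complex. -/
theorem subsingleton_reducedHomology_of_link_of_deletion {Δ : SimpComplex V} {x : V}
    (hx : {x} ∈ Δ.faces) {i : ℤ}
    (hlink : Subsingleton ((Δ.link {x} hx).ReducedHomology k (i - 1)))
    (hdel : Subsingleton ((Δ.deletion x).ReducedHomology k i)) :
    Subsingleton (Δ.ReducedHomology k i) := by
  rw [subsingleton_reducedHomology_iff] at hlink hdel ⊢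
  rw [sub_add_cancel] at hlink
  intro z hz hz0
  have hlk : ∀ {t : Finset V}, t ∈ (Δ.link {x} hx).faces ↔ x ∉ t ∧ insert x t ∈ Δ.faces := by
    intro t
    rw [mem_link, Finset.disjoint_singleton_left, Finset.insert_eq]
  -- Split the cycle into the part `z₀` avoiding `x` and the part `z₁` through `x`. As `∂z₁ = -∂z₀`
  -- avoids `x`, it is a chain of the link.
  obtain ⟨z₀, z₁, hz₀, hz₁, rfl⟩ : ∃ z₀ z₁ : Finset V →₀ k,
      z₀ ∈ Finsupp.supported k k {s | (s ∈ Δ.faces ∧ (s.card : ℤ) - 1 = i) ∧ x ∉ s} ∧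
      z₁ ∈ Finsupp.supported k k {s | (s ∈ Δ.faces ∧ (s.card : ℤ) - 1 = i) ∧ x ∈ s} ∧
      z₀ + z₁ = z := by
    refine ⟨z.filter (fun s => x ∉ s), z.filter (fun s => ¬ x ∉ s), ?_, ?_,
      Finsupp.filter_add_filter_not z _⟩
    · intro s hs
      simp only [Finsupp.support_filter, Finset.coe_filter, Set.mem_ofPred_eq] at hs
      exact ⟨hz hs.1, hs.2⟩
    · intro s hs
      simp only [Finsupp.support_filter, Finset.coe_filter, Set.mem_ofPred_eq, not_not] at hs
      exact ⟨hz hs.1, hs.2⟩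
  have hsum : boundary k z₀ + boundary k z₁ = 0 := by rw [← map_add, hz0]
  have hu₀ : boundary k z₁ ∈ Finsupp.supported k k {t : Finset V | x ∉ t} := by
    rw [eq_neg_of_add_eq_zero_right hsum]
    exact Submodule.neg_mem _ (boundary_mem_supported
      (fun s hs y _ h => hs.2 (Finset.mem_of_mem_erase h)) hz₀)
  have hu₁ : boundary k z₁ ∈ Finsupp.supported k k
      {t : Finset V | x ∈ t ∨ insert x t ∈ Δ.faces ∧ (t.card : ℤ) - 1 = i - 1} := by
    refine boundary_mem_supported (fun s hs y hy => ?_) hz₁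
    by_cases hyx : y = x
    · subst hyx
      right
      rw [Finset.insert_erase hy]
      refine ⟨hs.1.1, ?_⟩
      have h1 := hs.1.2
      have h2 := Finset.card_erase_add_one hy
      omega
    · left
      exact Finset.mem_erase.2 ⟨Ne.symm hyx, hs.2⟩
  have hu : boundary k z₁ ∈ (Δ.link {x} hx).chains k (i - 1) := by
    intro t ht
    have h0 : x ∉ t := hu₀ ht
    rcases hu₁ ht with h1 | h1
    · exact absurd h1 h0
    · exact ⟨hlk.2 ⟨h0, h1.1⟩, h1.2⟩
  have hjoin : joinVertex k x (boundary k z₁) = z₁ := by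
    have h1 := boundary_joinVertex_add k x z₁
    have h2 : joinVertex k x z₁ = 0 := by
      have : joinVertex k x z₁ ∈ Finsupp.supported k k (∅ : Set (Finset V)) :=
        joinVertex_mem_supported (fun s hs h => absurd hs.2 h) hz₁
      rwa [Finsupp.supported_empty, Submodule.mem_bot] at this
    rwa [h2, map_zero, zero_add] at h1
  -- The homotopy formula, applied twice, writes `∂∂z₁` as a join with `x`, while all its terms
  -- avoid `x`.
  have hcyc : boundary k (boundary k z₁) = 0 := by
    have h1 := boundary_joinVertex_add k x (boundary k z₁)
    rw [hjoin, add_eq_left] at h1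
    have h2 := boundary_joinVertex_add k x (boundary k (boundary k z₁))
    rw [h1, map_zero, zero_add] at h2
    have h3 : boundary k (boundary k z₁) ∈ Finsupp.supported k k {t : Finset V | x ∉ t} :=
      boundary_mem_supported (S := {t | x ∉ t}) (T := {t | x ∉ t})
        (fun s hs y _ h => hs (Finset.mem_of_mem_erase h)) hu₀
    have h4 : boundary k (boundary k z₁) ∈ Finsupp.supported k k {t : Finset V | x ∈ t} := by
      rw [← h2]
      exact joinVertex_mem_supported (S := Set.univ) (fun s _ _ => Finset.mem_insert_self _ _)
        (by simp [Finsupp.supported_univ])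
    rw [← Finsupp.support_eq_empty, Finset.eq_empty_iff_forall_notMem]
    exact fun t ht => h3 ht (h4 ht)
  obtain ⟨w, hw, hwz⟩ := hlink _ hu hcyc
  obtain ⟨v, hv, hvz⟩ := hdel (z₀ + w) (by
      refine Submodule.add_mem _ (fun s hs => ?_) (fun s hs => ?_)
      · have := hz₀ hs
        exact ⟨mem_deletion.2 ⟨this.1.1, this.2⟩, this.1.2⟩
      · have := hw hs
        have h' := hlk.1 this.1
        exact ⟨mem_deletion.2 ⟨Δ.down_closed _ h'.2 _ (Finset.subset_insert _ _), h'.1⟩,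
          this.2⟩) (by rw [map_add, hwz, hsum])
  -- With `∂w = ∂z₁` and `∂v = z₀ + w`, the homotopy formula gives `∂(x * w) = w - z₁`, where `x *
  -- w` is the join, so the difference bounds `z₀ + z₁`.
  refine ⟨v - joinVertex k x w, Submodule.sub_mem _ (fun s hs => ?_)
    (joinVertex_mem_supported (fun s hs hxs => ?_) hw), ?_⟩
  · have := hv hs
    exact ⟨(mem_deletion.1 this.1).1, this.2⟩
  · refine ⟨(hlk.1 hs.1).2, ?_⟩
    have := hs.2
    rw [Finset.card_insert_of_notMem hxs]
    push_cast
    omega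
  · have h1 := boundary_joinVertex_add k x w
    rw [hwz, hjoin] at h1
    rw [map_sub, hvz, eq_sub_of_add_eq h1]
    abel

/-- A complex whose edges do not leave a set of vertices `A` is disconnected as soon as it has
vertices both inside and outside of `A`. -/
theorem not_subsingleton_reducedHomology_zero {Δ : SimpComplex V} (A : Set V)
    (hA : ∀ x y, {x, y} ∈ Δ.faces → x ∈ A → y ∈ A) {u v : V} (hu : {u} ∈ Δ.faces)
    (hv : {v} ∈ Δ.faces) (huA : u ∈ A) (hvA : v ∉ A) :
    ¬ Subsingleton (Δ.ReducedHomology k 0) := by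
  classical
  rw [subsingleton_reducedHomology_iff]
  intro h
  -- `f` sums the coefficients of the vertices in `A`. It kills boundaries of edges, whose ends are
  -- both in `A` or both outside, but takes the value `1` on the cycle `u - v`.
  let f : (Finset V →₀ k) →ₗ[k] k :=
    Finsupp.linearCombination k fun s : Finset V => if ∃ x ∈ A, s = {x} then 1 else 0
  have hf : ∀ x c, f (Finsupp.single {x} c) = if x ∈ A then c else 0 := by
    intro x c
    simp [f]
  have hcone : ∀ x : V, boundary k (Finsupp.single {x} 1) = Finsupp.single ∅ 1 := by
    intro x
    rw [boundary_single, Finset.sum_singleton, Finset.erase_singleton, Finset.filter_singleton,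
      if_neg (lt_irrefl x), Finset.card_empty, pow_zero]
  obtain ⟨w, hw, hwz⟩ := h (Finsupp.single {u} 1 - Finsupp.single {v} 1)
    (Submodule.sub_mem _ (Finsupp.single_mem_supported k _ ⟨hu, by simp⟩)
      (Finsupp.single_mem_supported k _ ⟨hv, by simp⟩)) (by rw [map_sub, hcone, hcone, sub_self])
  have hker : boundary k w ∈ LinearMap.ker f := by
    refine linearCombination_mem (fun s hs => ?_) hw
    have hcard : s.card = 2 := by
      have := hs.2
      omega
    obtain ⟨x, y, hxy, rfl⟩ : ∃ x y, x < y ∧ s = {x, y} := by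
      obtain ⟨x, y, hne, rfl⟩ := Finset.card_eq_two.1 hcard
      rcases lt_or_gt_of_ne hne with h | h
      · exact ⟨x, y, h, rfl⟩
      · exact ⟨y, x, h, Finset.pair_comm _ _⟩
    have hmem : x ∈ A ↔ y ∈ A := ⟨hA x y hs.1, hA y x (Finset.pair_comm x y ▸ hs.1)⟩
    have e1 : ({x, y} : Finset V).erase x = {y} := by
      rw [Finset.erase_insert (by simp [hxy.ne])]
    have e2 : ({x, y} : Finset V).erase y = {x} := by
      rw [Finset.pair_comm, Finset.erase_insert (by simp [hxy.ne'])]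
    have e3 : ({x, y} : Finset V).filter (fun z => z < x) = ∅ := by
      simp [Finset.filter_insert, Finset.filter_singleton, hxy.le]
    have e4 : ({x, y} : Finset V).filter (fun z => z < y) = {x} := by
      simp [Finset.filter_insert, Finset.filter_singleton, hxy]
    rw [LinearMap.mem_ker, Finset.sum_pair hxy.ne, e1, e2, e3, e4, map_add, hf, hf]
    by_cases hxA : x ∈ A
    · simp [hxA, hmem.1 hxA]
    · simp [hxA, mt hmem.2 hxA]
  rw [hwz, LinearMap.mem_ker, map_sub, hf, hf, if_pos huA, if_neg hvA, sub_zero] at hker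
  exact one_ne_zero hker

end Acyclicity

/-! ### Cohen–Macaulay and Buchsbaum complexes. -/

section CohenMacaulay

variable {k : Type*} [Field k] {V : Type*} [LinearOrder V]

theorem CohenMacaulay.buchsbaum {Δ : SimpComplex V} (h : Δ.CohenMacaulay k) :
    Δ.Buchsbaum k := by
  refine ⟨h.1, fun x hx => ⟨h.1.link hx, fun F hF i hi => ?_⟩⟩
  have := (mem_link.1 hF).2
  rw [link_link hx hF this rfl] at hi ⊢
  exact h.2 _ this i hi

/-- The link of a nonempty face is a link inside the link of any of its vertices. -/
theorem Buchsbaum.subsingleton_reducedHomology_link {Δ : SimpComplex V} (h : Δ.Buchsbaum k)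
    {F : Finset V} (hF : F ∈ Δ.faces) (hne : F.Nonempty) {i : ℤ} (hi : i < (Δ.link F hF).dim) :
    Subsingleton ((Δ.link F hF).ReducedHomology k i) := by
  obtain ⟨x, hx⟩ := hne
  have hx' : {x} ∈ Δ.faces := Δ.down_closed F hF _ (Finset.singleton_subset_iff.2 hx)
  have hu : {x} ∪ F.erase x = F := by rw [← Finset.insert_eq, Finset.insert_erase hx]
  have hmem : F.erase x ∈ (Δ.link {x} hx').faces := mem_link.2 ⟨by simp, by rwa [hu]⟩
  have := (h.2 x hx').2 _ hmem i
  rw [link_link hx' hmem hF hu] at this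
  exact this hi

theorem cohenMacaulay_of_faces_eq_powerset {Δ : SimpComplex V} {A : Finset V}
    (h : Δ.faces = A.powerset) : Δ.CohenMacaulay k := by
  have hm : ∀ {F}, F ∈ Δ.faces ↔ F ⊆ A := by simp [h]
  have hfac : ∀ F, Δ.IsFacet F → F = A := fun F hF => hF.eq_of_subset (hm.2 subset_rfl) (hm.1 hF.1)
  refine ⟨fun F G hF hG => by rw [hfac F hF, hfac G hG], fun F hF i hi => ?_⟩
  obtain ⟨G, hG, hiG⟩ := card_lt_of_lt_dim hi
  -- Links in a simplex are simplices: an empty `G` forces `i < -1`, and otherwise the link is a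
  -- cone.
  rcases G.eq_empty_or_nonempty with rfl | ⟨x, hx⟩
  · exact subsingleton_reducedHomology_of_lt (by simpa using hiG)
  · have hG' := mem_link.1 hG
    refine subsingleton_reducedHomology_of_cone (x := x) (fun H hH => ?_) i
    rw [mem_link, hm] at hH ⊢
    refine ⟨Finset.disjoint_insert_right.2 ⟨Finset.disjoint_right.1 hG'.1 hx, hH.1⟩, ?_⟩
    rw [Finset.union_insert]
    exact Finset.insert_subset (hm.1 hG'.2 (Finset.mem_union_right _ hx)) hH.2

variable {C D : Type*}

/-- If another vertex shares the colour of `x`, the deletion of `x` keeps all colours and the link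
loses one, matching the degree shift in Mayer–Vietoris. If none does, the complex is a cone over
`x`. -/
theorem subsingleton_reducedHomology_fiberJoin_id [DecidableEq C] (W : Finset V) (p : V → C)
    (i : ℤ) (hi : i < ((W.image p).card : ℤ) - 1) :
    Subsingleton ((fiberJoin W p id).ReducedHomology k i) := by
  induction W using Finset.strongInduction generalizing i with
  | H W ih =>
    rcases W.eq_empty_or_nonempty with rfl | ⟨x, hx⟩
    · exact subsingleton_reducedHomology_of_lt (by simpa using hi)
    · have hx' := singleton_mem_fiberJoin (p := p) (q := id).2 hx
      by_cases hcol : ∃ y ∈ W, y ≠ x ∧ p y = p x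
      · obtain ⟨y, hy, hyx, hpy⟩ := hcol
        apply subsingleton_reducedHomology_of_link_of_deletion hx'
        · rw [link_fiberJoin_id]
          refine ih _ (Finset.filter_ssubset.2 ⟨x, hx, by simp⟩) _ ?_
          have : (W.filter fun v => p v ∉ ({x} : Finset V).image p).image p =
              (W.image p).erase (p x) := by
            ext c
            simp only [Finset.image_singleton, Finset.mem_singleton, Finset.mem_image,
              Finset.mem_filter, Finset.mem_erase]
            constructor
            · rintro ⟨v, ⟨hv, hne⟩, rfl⟩
              exact ⟨hne, v, hv, rfl⟩
            · rintro ⟨hne, v, hv, rfl⟩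
              exact ⟨v, ⟨hv, hne⟩, rfl⟩
          have h2 := Finset.card_erase_add_one (Finset.mem_image_of_mem p hx)
          rw [this]
          omega
        · rw [deletion_fiberJoin]
          refine ih _ (Finset.erase_ssubset hx) _ ?_
          have : (W.erase x).image p = W.image p := by
            refine (Finset.image_subset_image (Finset.erase_subset _ _)).antisymm fun c hc => ?_
            obtain ⟨v, hv, rfl⟩ := Finset.mem_image.1 hc
            by_cases hvx : v = x
            · exact Finset.mem_image.2 ⟨y, Finset.mem_erase.2 ⟨hyx, hy⟩, hvx ▸ hpy⟩
            · exact Finset.mem_image_of_mem p (Finset.mem_erase.2 ⟨hvx, hv⟩)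
          rwa [this]
      · push Not at hcol
        refine subsingleton_reducedHomology_of_cone (x := x) (fun F hF => ?_) i
        refine insert_mem_fiberJoin hF hx fun y hy h => ?_
        by_contra hne
        exact hcol y ((mem_fiberJoin.1 hF).1 hy) hne h

theorem cohenMacaulay_fiberJoin_id (W : Finset V) (p : V → C) :
    (fiberJoin W p id).CohenMacaulay k := by
  classical
  refine ⟨isPure_fiberJoin_of_injOn (fun u v h => congrArg p h) Function.injective_id,
    fun F hF i hi => ?_⟩
  obtain ⟨G, hG, hiG⟩ := card_lt_of_lt_dim hi
  rw [link_fiberJoin_id] at hG ⊢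
  have hm := mem_fiberJoin.1 hG
  refine subsingleton_reducedHomology_fiberJoin_id _ _ _ (hiG.trans_le ?_)
  have : G.card ≤ ((W.filter fun v => p v ∉ F.image p).image p).card := by
    rw [← Finset.card_image_of_injOn (s := G) (f := p) fun u hu v hv h => hm.2 u hu v hv h]
    exact Finset.card_le_card (Finset.image_subset_image hm.1)
  omega

end CohenMacaulay

end SimpComplex

/-! ### One-paired circulants. -/

open SimpComplex

/-- Divisors of `n` do not distinguish a difference `d` from `n - d`, and one of the two is at most
`n / 2`. -/
theorem onePairedCirculant_adj {n : ℕ} [NeZero n] {a b : ℕ} (hab : a * b ∣ n) (u v : Fin n) :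
    (onePairedCirculant n a b).Adj u v ↔
      (u : ℕ) % a = v % a ∧ (u : ℕ) % (a * b) ≠ v % (a * b) := by
  wlog huv : (v : ℕ) ≤ u generalizing u v
  · rw [SimpleGraph.adj_comm, this v u (le_of_not_ge huv), ne_comm, eq_comm]
  have hu := u.isLt
  rcases huv.eq_or_lt with he | hlt
  · have : v = u := Fin.ext he
    subst this
    simp
  have hne : u ≠ v := fun h => hlt.ne (h ▸ rfl)
  have h1 : ((u - v : Fin n) : ℕ) = u - v := Fin.sub_val_of_le huv
  have h2 : ((v - u : Fin n) : ℕ) = n - (u - v) := by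
    rw [Fin.val_sub, Nat.mod_eq_of_lt (by omega)]
    omega
  have hdvd : ∀ c, c ∣ n → (c ∣ n - ((u : ℕ) - v) ↔ c ∣ (u : ℕ) - v) := fun c hc =>
    Nat.dvd_sub_iff_right (by omega) hc
  have hmod : ∀ c, (u : ℕ) % c = v % c ↔ c ∣ (u : ℕ) - v := fun c => by
    rw [← Nat.modEq_iff_dvd' huv, eq_comm]
    rfl
  simp only [onePairedCirculant, circulant, SimpleGraph.circulantGraph_adj, Set.mem_ofPred_eq, h1,
    h2, hdvd a (dvd_of_mul_right_dvd hab), hdvd _ hab, Ne, hmod]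
  constructor
  · rintro ⟨_, h | h⟩
    · exact h.2.2
    · exact h.2.2
  · intro h
    refine ⟨hne, ?_⟩
    by_cases hd : (u : ℕ) - v ≤ n / 2
    · exact Or.inl ⟨by omega, hd, h⟩
    · exact Or.inr ⟨by omega, by omega, h⟩

theorem indComplex_onePairedCirculant {n : ℕ} [NeZero n] {a b : ℕ} (hab : a * b ∣ n) :
    indComplex (onePairedCirculant n a b) =
      fiberJoin Finset.univ (fun v : Fin n => (v : ℕ) % a) (fun v => (v : ℕ) % (a * b)) := by
  ext F
  rw [mem_fiberJoin]
  simp only [indComplex, Finset.mem_filter, Finset.mem_univ, true_and, Finset.subset_univ,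
    SimpleGraph.isIndepSet_iff, Set.Pairwise, Finset.mem_coe, onePairedCirculant_adj hab]
  constructor
  · intro h u hu v hv huv
    by_cases he : u = v
    · rw [he]
    · by_contra hne
      exact h hu hv he ⟨huv, hne⟩
  · exact fun h u hu v hv _ hadj => hadj.2 (h u hu v hv hadj.1)

theorem card_filter_mod_eq {n d : ℕ} (hd : 0 < d) (hdn : d ∣ n) (r : ℕ) :
    (Finset.univ.filter fun u : Fin n => (u : ℕ) % d = r % d).card = n / d := by
  have h1 := Nat.count_modEq_card n hd r
  rw [Nat.mod_eq_zero_of_dvd hdn, if_neg (Nat.not_lt_zero _), add_zero] at h1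
  rw [← h1, Nat.count_eq_card_filter_range, ← Finset.card_map Fin.valEmbedding]
  congr 1
  ext v
  simp only [Finset.mem_map, Finset.mem_filter, Finset.mem_univ, true_and, Finset.mem_range]
  exact ⟨fun ⟨u, hu, huv⟩ => huv ▸ ⟨u.isLt, hu⟩, fun h => ⟨⟨v, h.1⟩, h.2, rfl⟩⟩

theorem isPure_indComplex_onePairedCirculant {n : ℕ} [NeZero n] {a b : ℕ} (ha : 0 < a)
    (hb : 0 < b) (hab : a * b ∣ n) : (indComplex (onePairedCirculant n a b)).IsPure := by
  rw [indComplex_onePairedCirculant hab]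
  refine isPure_fiberJoin (fun u v h => ?_)
    fun v _ => card_filter_mod_eq (Nat.mul_pos ha hb) hab v
  exact Nat.ModEq.of_mul_right b h

theorem indComplex_onePairedCirculant_mul {n : ℕ} [NeZero n] {a b : ℕ} (h : n = a * b) :
    indComplex (onePairedCirculant n a b) =
      fiberJoin Finset.univ (fun v : Fin n => (v : ℕ) % a) id := by
  rw [indComplex_onePairedCirculant h.symm.dvd]
  ext F
  simp only [mem_fiberJoin, ← h, Nat.mod_eq_of_lt (Fin.isLt _), Fin.val_inj, id]

theorem sdiff_ne_singleton_of_isFacet_onePairedCirculant {n : ℕ} [NeZero n] {a b : ℕ} (ha : 0 < a)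
    (hb : 0 < b) (hab : a * b ∣ n) (hlt : a * b < n) {F G : Finset (Fin n)}
    (hF : (indComplex (onePairedCirculant n a b)).IsFacet F)
    (hG : (indComplex (onePairedCirculant n a b)).IsFacet G) (x : Fin n) : F \ G ≠ {x} := by
  rw [indComplex_onePairedCirculant hab] at hF hG
  refine sdiff_ne_singleton_of_isFacet_fiberJoin
    (fun u v h => Nat.ModEq.of_mul_right b h) (fun v _ => ?_) hF hG x
  have hpos := Nat.mul_pos ha hb
  have hcard := card_filter_mod_eq hpos hab v
  have h2 : 1 < n / (a * b) := by
    obtain ⟨m, rfl⟩ := hab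
    rw [Nat.mul_div_cancel_left _ hpos]
    exact (Nat.lt_mul_iff_one_lt_right hpos).1 hlt
  rw [← hcard] at h2
  obtain ⟨u, hu, hne⟩ := Finset.exists_mem_ne h2 v
  exact ⟨u, Finset.mem_univ u, hne, (Finset.mem_filter.1 hu).2⟩

theorem exists_ne_isFacet_onePairedCirculant {n : ℕ} [NeZero n] {a b : ℕ} (ha : 0 < a)
    (hb : 1 < b) (hab : a * b ∣ n) :
    ∃ F G, (indComplex (onePairedCirculant n a b)).IsFacet F ∧
      (indComplex (onePairedCirculant n a b)).IsFacet G ∧ F ≠ G := by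
  have hlt : a < a * b := (Nat.lt_mul_iff_one_lt_right ha).2 hb
  have hle : a * b ≤ n := Nat.le_of_dvd (NeZero.pos n) hab
  rw [indComplex_onePairedCirculant hab]
  refine exists_ne_isFacet_fiberJoin (u := ⟨0, NeZero.pos n⟩) (v := ⟨a, by omega⟩)
    (Finset.mem_univ _) (Finset.mem_univ _) ?_ ?_
  · simp
  · simp only [Nat.zero_mod, Nat.mod_eq_of_lt hlt]
    exact ha.ne

/-- If `n ≠ ab`, then the link of a facet of the join of all but one of the disconnected
complexes is disconnected and not zero-dimensional. -/
theorem exists_disconnected_link_onePairedCirculant (k : Type*) [Field k] {n : ℕ} [NeZero n]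
    {a b : ℕ} (ha : 0 < a) (hb : 1 < b) (hab : a * b ∣ n) (hlt : a * b < n) :
    ∃ (F : Finset (Fin n)) (hF : F ∈ (indComplex (onePairedCirculant n a b)).faces),
      (1 < a → F.Nonempty) ∧ 0 < ((indComplex (onePairedCirculant n a b)).link F hF).dim ∧
      ¬ Subsingleton (((indComplex (onePairedCirculant n a b)).link F hF).ReducedHomology k 0) := by
  have halt : a < a * b := (Nat.lt_mul_iff_one_lt_right ha).2 hb
  rw [indComplex_onePairedCirculant hab]
  -- For each residue `r ≠ 0` mod `a`, choose the class of `r` mod `a * b`. Only the factor of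
  -- residue `0` is left free, and `F` is empty when `a = 1`.
  let F : Finset (Fin n) :=
    Finset.univ.filter fun v => (v : ℕ) % a ≠ 0 ∧ (v : ℕ) % (a * b) = (v : ℕ) % a
  have hmF : ∀ v, v ∈ F ↔ (v : ℕ) % a ≠ 0 ∧ (v : ℕ) % (a * b) = (v : ℕ) % a := by simp [F]
  have hF : F ∈ (fiberJoin Finset.univ (fun v : Fin n => (v : ℕ) % a)
      (fun v => (v : ℕ) % (a * b))).faces := by
    refine mem_fiberJoin.2 ⟨Finset.subset_univ _, fun u hu v hv huv => ?_⟩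
    rw [((hmF u).1 hu).2, ((hmF v).1 hv).2]
    exact huv
  have hlink : ∀ G : Finset (Fin n), (∀ v ∈ G, (v : ℕ) % a = 0) →
      (∀ u ∈ G, ∀ v ∈ G, (u : ℕ) % (a * b) = v % (a * b)) →
      G ∈ ((fiberJoin Finset.univ (fun v : Fin n => (v : ℕ) % a)
        (fun v => (v : ℕ) % (a * b))).link F hF).faces := by
    intro G h0 hG
    rw [mem_link]
    refine ⟨Finset.disjoint_left.2 fun v hv hv' => ((hmF v).1 hv).1 (h0 v hv'),
      mem_fiberJoin.2 ⟨Finset.subset_univ _, fun u hu v hv huv => ?_⟩⟩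
    rcases Finset.mem_union.1 hu with hu | hu <;> rcases Finset.mem_union.1 hv with hv | hv
    · exact (mem_fiberJoin.1 hF).2 u hu v hv huv
    · exact absurd (huv.trans (h0 v hv)) ((hmF u).1 hu).1
    · exact absurd (huv.symm.trans (h0 u hu)) ((hmF v).1 hv).1
    · exact hG u hu v hv
  have hlink0 : ∀ G, G ∈ ((fiberJoin Finset.univ (fun v : Fin n => (v : ℕ) % a)
        (fun v => (v : ℕ) % (a * b))).link F hF).faces → ∀ v ∈ G, (v : ℕ) % a = 0 := by
    intro G hG v hv
    rw [mem_link] at hG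
    by_contra hne
    have hr : (v : ℕ) % a < a * b := (Nat.mod_lt _ ha).trans halt
    -- The residue `w` of `v` mod `a` itself lies in `F`, which forces `v` into the class of `w` mod
    -- `a * b`, hence into `F`.
    let w : Fin n := ⟨(v : ℕ) % a, hr.trans hlt⟩
    have hw : w ∈ F := by
      rw [hmF]
      simp only [w, Nat.mod_mod, Nat.mod_eq_of_lt hr]
      exact ⟨hne, trivial⟩
    have := (mem_fiberJoin.1 hG.2).2 v (Finset.mem_union_right _ hv) w
      (Finset.mem_union_left _ hw) (by simp [w])
    simp only [w, Nat.mod_eq_of_lt hr] at this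
    exact Finset.disjoint_left.1 hG.1 ((hmF v).2 ⟨hne, this⟩) hv
  have hsingle : ∀ v : Fin n, (v : ℕ) % a = 0 →
      {v} ∈ ((fiberJoin Finset.univ (fun v : Fin n => (v : ℕ) % a)
        (fun v => (v : ℕ) % (a * b))).link F hF).faces := by
    intro v hv
    refine hlink _ (by simpa using hv) ?_
    simp
  refine ⟨F, hF, fun h1 => ⟨⟨1, by omega⟩, ?_⟩, ?_, ?_⟩
  · rw [hmF]
    simp [Nat.mod_eq_of_lt h1, Nat.mod_eq_of_lt (h1.trans halt)]
  -- Here `a * b < n` matters: `{0, a * b}` is an edge of the link.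
  · have hmem := hlink {⟨0, NeZero.pos n⟩, ⟨a * b, hlt⟩} (by simp) (by simp)
    have := card_le_dim hmem
    rw [Finset.card_pair (by
      rw [Ne, Fin.mk.injEq]
      omega)] at this
    push_cast at this
    omega
  -- The vertices `0` and `a` lie in different components, being congruent mod `a` but not mod `a *
  -- b`.
  · refine not_subsingleton_reducedHomology_zero {v : Fin n | (v : ℕ) % (a * b) = 0}
      (fun x y hxy hx => ?_) (hsingle ⟨0, NeZero.pos n⟩ (by simp))
      (hsingle ⟨a, halt.trans hlt⟩ (by simp)) (by simp) ?_
    · have h1 := hlink0 _ hxy x (by simp)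
      have h2 := hlink0 _ hxy y (by simp)
      have h3 := (mem_fiberJoin.1 (mem_link.1 hxy).2).2 y (by simp) x (by simp) (h2.trans h1.symm)
      exact h3.trans hx
    · simp only [Set.mem_ofPred_eq, Nat.mod_eq_of_lt halt]
      exact ha.ne'

/-- With a single factor, the complex is a disjoint union of simplices, and the link of `x` is the
simplex on the rest of its class mod `b`. -/
theorem buchsbaum_onePairedCirculant_one (k : Type*) [Field k] {n : ℕ} [NeZero n] {b : ℕ}
    (hb : 0 < b) (hbn : 1 * b ∣ n) : (indComplex (onePairedCirculant n 1 b)).Buchsbaum k := by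
  refine ⟨isPure_indComplex_onePairedCirculant one_pos hb hbn, ?_⟩
  rw [indComplex_onePairedCirculant hbn]
  intro x hx
  refine cohenMacaulay_of_faces_eq_powerset (A := Finset.univ.filter fun v : Fin n =>
    x ≠ v ∧ (v : ℕ) % (1 * b) = x % (1 * b)) ?_
  ext G
  rw [mem_link, mem_fiberJoin, Finset.mem_powerset, Finset.disjoint_singleton_left]
  simp only [Nat.mod_one, true_implies, Finset.subset_univ, true_and]
  constructor
  · rintro ⟨hxG, h⟩ v hv
    refine Finset.mem_filter.2 ⟨Finset.mem_univ v, fun he => hxG (he ▸ hv), ?_⟩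
    exact h v (Finset.mem_union_right _ hv) x (by simp)
  · intro h
    have hall : ∀ v ∈ {x} ∪ G, (v : ℕ) % (1 * b) = x % (1 * b) := by
      intro v hv
      rcases Finset.mem_union.1 hv with hv | hv
      · rw [Finset.mem_singleton.1 hv]
      · exact (Finset.mem_filter.1 (h hv)).2.2
    exact ⟨fun hx => (Finset.mem_filter.1 (h hx)).2.1 rfl,
      fun u hu v hv => (hall u hu).trans (hall v hv).symm⟩

theorem corollary5p9 (k : Type*) [Field k] (n : ℕ) [NeZero n] (a b : ℕ)
    (ha : 0 < a) (hb : 0 < b) (hab : a * b ∣ n) (hb1 : b = 1 → n = a) :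
    (((indComplex (onePairedCirculant n a b)).VertexDecomposable ↔ n = a * b) ∧
      ((indComplex (onePairedCirculant n a b)).Shellable ↔ n = a * b) ∧
      ((indComplex (onePairedCirculant n a b)).CohenMacaulay k ↔ n = a * b)) ∧
    (((indComplex (onePairedCirculant n a b)).Buchsbaum k ∧
        ¬ (indComplex (onePairedCirculant n a b)).CohenMacaulay k) ↔ a = 1 ∧ a * b < n) ∧
    (((indComplex (onePairedCirculant n a b)).IsPure ∧
        ¬ (indComplex (onePairedCirculant n a b)).Buchsbaum k) ↔ 1 < a ∧ a * b < n) := by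
  have hpure := isPure_indComplex_onePairedCirculant ha hb hab
  rcases (Nat.le_of_dvd (NeZero.pos n) hab).eq_or_lt with he | hlt
  · have he := he.symm
    have hVD : (indComplex (onePairedCirculant n a b)).VertexDecomposable := by
      rw [indComplex_onePairedCirculant_mul he]
      exact vertexDecomposable_fiberJoin_id _ _
    have hSh : (indComplex (onePairedCirculant n a b)).Shellable := by
      rw [indComplex_onePairedCirculant_mul he]
      exact shellable_fiberJoin_id _ _ (fun v => (v : ℕ)) Fin.val_injective
    have hCM : (indComplex (onePairedCirculant n a b)).CohenMacaulay k := by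
      rw [indComplex_onePairedCirculant_mul he]
      exact cohenMacaulay_fiberJoin_id _ _
    have hnlt : ¬ a * b < n := he.not_gt
    exact ⟨⟨iff_of_true hVD he, iff_of_true hSh he, iff_of_true hCM he⟩,
      iff_of_false (fun h => h.2 hCM) (fun h => hnlt h.2),
      iff_of_false (fun h => h.2 hCM.buchsbaum) (fun h => hnlt h.2)⟩
  -- For `b = 1` the hypothesis gives `n = a = a * b`, which is the other case.
  · have hb' : 1 < b := by
      by_contra hle
      have hb2 : b = 1 := by omega
      rw [hb1 hb2, hb2, mul_one] at hlt
      exact lt_irrefl _ hlt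
    obtain ⟨F, G, hF, hG, hne⟩ := exists_ne_isFacet_onePairedCirculant ha hb' hab
    have hadj := @sdiff_ne_singleton_of_isFacet_onePairedCirculant n _ a b ha hb hab hlt
    obtain ⟨E, hE, hEne, hdim, hhom⟩ :=
      exists_disconnected_link_onePairedCirculant k ha hb' hab hlt
    have hVD : ¬ (indComplex (onePairedCirculant n a b)).VertexDecomposable := fun h => by
      obtain ⟨F', G', x, hF', hG', hx⟩ := h.exists_adjacent_facets hF hG hne
      exact hadj hF' hG' x hx
    have hSh : ¬ (indComplex (onePairedCirculant n a b)).Shellable := fun h => by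
      obtain ⟨F', G', x, hF', hG', hx⟩ := h.exists_adjacent_facets hF hG hne
      exact hadj hF' hG' x hx
    have hCM : ¬ (indComplex (onePairedCirculant n a b)).CohenMacaulay k :=
      fun h => hhom (h.2 E hE 0 hdim)
    have hBu : (indComplex (onePairedCirculant n a b)).Buchsbaum k ↔ a = 1 := by
      constructor
      · intro h
        by_contra h1
        exact hhom (h.subsingleton_reducedHomology_link hE (hEne (by omega)) hdim)
      · rintro rfl
        exact buchsbaum_onePairedCirculant_one k hb hab
    have hnab : n ≠ a * b := hlt.ne'
    refine ⟨⟨iff_of_false hVD hnab, iff_of_false hSh hnab, iff_of_false hCM hnab⟩, ?_, ?_⟩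
    · rw [hBu]
      exact ⟨fun h => ⟨h.1, hlt⟩, fun h => ⟨h.1, hCM⟩⟩
    · rw [hBu]
      exact ⟨fun h => ⟨by omega, hlt⟩, fun h => ⟨hpure, by omega⟩⟩
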